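/- Let $\mathcal P$ be a finite graded poset of rank $d+1$ with minimum $\mathbf 0$ and maximum $\mathbf 1$. For $S\subseteq[d]=\{1,\dots,d\}$ let $W_S(\mathcal P)$ be the number of chains $c_1\prec c_2\prec\cdots\prec c_k$ in $\mathcal P$ with $\{\operatorname{rk}c_1,\dots,\operatorname{rk}c_k\}=S$, and let $\mathbf W(\mathcal P)=(W_S(\mathcal P))_{S\subseteq[d]}\in\mathbb R^{2^{[d]}}$ be the flag-vector of $\mathcal P$. A zonotope is a translate of a set $\{\lambda_1z_1+\cdots+\lambda_kz_k : -1\le\lambda_1,\dots,\lambda_k\le 1\}$ with nonzero $z_1,\dots,z_k\in\mathbb R^n$. The lattice of flats $\mathcal L(Z)$ of a zonotope $Z$ is the set of all linear subspaces $\mathsf L(F)$ parallel to the affine hull of a nonempty face $F$ of $Z$ (including $F=Z$), ordered by inclusion. Theorem. For every $d\ge 0$, the flag-vectors of the lattices of flats of $(d+1)$-dimensional zonotopes affinely span the flag-vectors of all finite graded posets of rank $d+1$ with minimum and maximum: $$\operatorname{aff}\{\mathbf W(\mathcal L(Z)) : Z\text{ a zonotope of dimension }d+1\}=\operatorname{aff}\{\mathbf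 W(\mathcal P) : \mathcal P\text{ a finite graded poset of rank }d+1\text{ with minimum and maximum}\},$$ and this (nonempty) affine space has dimension $2^d-1$. -/

import Mathlib

universe u

namespace ZonoFlag

/-- The flag-Whitney number of the second kind: the number of chains of `P` whose set of ranks is
`S`. The rank of an element `a` is `Order.height a`, the length of a longest chain that ends
in `a`; in a finite graded poset with minimum this is the usual rank function. -/
noncomputable def flagWhitney (P : Type*) [PartialOrder P] (S : Set ℕ) : ℕ :=
  Set.ncard {c : Set P | IsChain (· ≤ ·) c ∧
    (fun a : P => Order.height a) '' c = (fun s : ℕ => (s : ℕ∞)) '' S}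

/-- The flag-vector of a poset of rank `d + 1`. The coordinates are indexed by the subsets of
`{1, …, d}`, written as finite sets of `i : Fin d`, where `i` stands for the rank `i + 1`. -/
noncomputable def flagVector (d : ℕ) (P : Type*) [PartialOrder P] : Finset (Fin d) → ℝ :=
  fun S => (flagWhitney P ((fun i : Fin d => (i : ℕ) + 1) '' (S : Set (Fin d))) : ℝ)

/-- `P` is a finite graded poset of rank `n`, with minimum and maximum: there is a function
`P → ℕ` that is strictly monotone, sends covers to covers (so it increases by one along each
cover), is `0` at the minimum and `n` at the maximum. -/
def IsGradedOfRank (P : Type*) [PartialOrder P] [BoundedOrder P] (n : ℕ) : Prop :=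
  Finite P ∧ ∃ _ : GradeMinOrder ℕ P, grade ℕ (⊤ : P) = n

/-- The flag-vectors of all finite graded posets of rank `d + 1` with minimum and maximum. -/
def posetFlagVectors (d : ℕ) : Set (Finset (Fin d) → ℝ) :=
  {v | ∃ (P : Type u) (_ : PartialOrder P) (_ : BoundedOrder P),
    IsGradedOfRank P (d + 1) ∧ v = flagVector d P}

section Zonotope

variable {E : Type*} [NormedAddCommGroup E] [NormedSpace ℝ E]

/-- `Z` is a zonotope: a translate of a Minkowski sum of segments `[-z₁, z₁] + ⋯ + [-zₖ, zₖ]`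
with nonzero `zᵢ`. -/
def IsZonotope (Z : Set E) : Prop :=
  ∃ (k : ℕ) (z : Fin k → E) (t : E), (∀ i, z i ≠ 0) ∧
    (fun x => t + x) '' Z =
      {x | ∃ r : Fin k → ℝ, (∀ i, -1 ≤ r i ∧ r i ≤ 1) ∧ x = ∑ i, r i • z i}

/-- The poset of flats of a polytope `Z`, ordered by inclusion: the linear subspaces parallel to
the affine hulls of the nonempty faces of `Z`, where `Z` counts as a face of itself. -/
def flats (Z : Set E) : Set (Submodule ℝ E) :=
  {L | ∃ F : Set E, F.Nonempty ∧ IsExposed ℝ Z F ∧ vectorSpan ℝ F = L}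

end Zonotope

/-- The flag-vectors of the lattices of flats of all `(d + 1)`-dimensional zonotopes, in Euclidean
spaces of any dimension. -/
def zonotopeFlagVectors (d : ℕ) : Set (Finset (Fin d) → ℝ) :=
  {v | ∃ (n : ℕ) (Z : Set (EuclideanSpace ℝ (Fin n))),
    IsZonotope Z ∧ Module.finrank ℝ (vectorSpan ℝ Z) = d + 1 ∧ v = flagVector d (flats Z)}

end ZonoFlag

/-!
All flag-vectors have `∅`-coordinate `1`, so they lie in a hyperplane of dimension `2 ^ d - 1`, and
the theorem follows once the flag-vectors of zonotopes *linearly* span the whole coordinate space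
(`span_zonotopeFlagVectors`): both affine spans are then that hyperplane, because the lattice of
flats of a zonotope is itself a finite graded poset
(`zonotopeFlagVectors_subset_posetFlagVectors`).

The face of a zonotope in direction `l` is a translate of the zonotope of the generators killed by
`l`. Hence the flats of the zonotope generated by a finite set `A` are exactly the spans of subsets
of `A` (`flats_zonotope`), graded by dimension, and everything becomes a question about the numbers
`flagCount A S` of flags of such spans with dimension set `S`.

The engine is free extension. If `e` avoids every span of dimension at most `d`, then the flags of
`insert e A` with rank set `S ⊆ {1, …, d}` are either flags of `A`, or there is a first rank `t ∈ S`
whose member contains `e`; forgetting `e` then gives a flag of `A` whose rank set is `S` with all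
ranks from `t` on lowered by one (`ncard_flagSet_insert`). Thus `flagCount (insert e A)` equals
`flagCount A + G (flagCount A)` on subsets of `{1, …, d}`, for a linear operator `G`
(`loweringOperator`) that is nilpotent there. Let `V_d` be the span of the functions `flagCount A`
with `A` of rank `d + 1`, taken modulo functions vanishing on the subsets of `{1, …, d}`
(`flagSpan`).

* Taking `e` generic in the span of `A`, the space `V_d` is invariant under `G`.
* Taking `A` of rank `d` and `e` outside its span, `(1 + G) (flagCount A) ∈ V_d`, and nilpotency of
  `G` gives `flagCount A ∈ V_d`. For such `A` the rank `d` is attained only by the top, so that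
  `flagCount A (S ∪ {d}) = flagCount A S`. Inductively, `V_d` contains every `v` with
  `v (S ∪ {d}) = v S` for all `S ⊆ {1, …, d - 1}` (`mem_flagSpan_of_insert_eq`).
* If `u` runs over the functions with `u (S ∪ {d}) = u S`, then the differences
  `G u (S ∪ {d}) - G u S` take arbitrary values (`exists_loweringOperator_sub_eq`). So any `v`
  differs from some `G u ∈ V_d` by a function of the previous kind, and `V_d` is everything
  (`flagSpan_eq_top`).
-/

namespace ZonoFlag

open Finset

/-! ### Lowering ranks in a rank set -/

/-- The rank set `S` with every rank from `t` on lowered by one. The rank `0`, which carries no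
information because a poset with minimum has exactly one element of rank `0`, is dropped. If
`t - 1` and `t` both lie in `S`, they are merged. -/
def lowered (t : ℕ) (S : Finset ℕ) : Finset ℕ :=
  (S.image fun s => if s < t then s else s - 1).erase 0

theorem mem_lowered {t r : ℕ} {S : Finset ℕ} :
    r ∈ lowered t S ↔ r ≠ 0 ∧ (r ∈ S ∧ r < t ∨ r + 1 ∈ S ∧ t ≤ r + 1) := by
  simp only [lowered, mem_erase, mem_image]
  refine and_congr_right fun hr => ⟨?_, ?_⟩
  · rintro ⟨s, hs, rfl⟩
    split_ifs with h
    · exact Or.inl ⟨hs, h⟩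
    · rw [if_neg h] at hr
      rw [Nat.sub_add_cancel (by omega)]
      exact Or.inr ⟨hs, by omega⟩
  · rintro (⟨h, h'⟩ | ⟨h, h'⟩)
    · exact ⟨r, h, if_pos h'⟩
    · exact ⟨r + 1, h, by rw [if_neg (by omega)]; rfl⟩

theorem lowered_subset_Icc {t d : ℕ} {S : Finset ℕ} (hS : S ⊆ Icc 1 (d + 1)) (ht : t ∈ S) :
    lowered t S ⊆ Icc 1 d := by
  intro r hr
  have ht' := mem_Icc.1 (hS ht)
  rcases mem_lowered.1 hr with ⟨h0, ⟨-, h⟩ | ⟨h, -⟩⟩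
  · exact mem_Icc.2 (by omega)
  · have := mem_Icc.1 (hS h)
    exact mem_Icc.2 (by omega)

theorem lowered_insert_self {d : ℕ} {S : Finset ℕ} (hS : S ⊆ Icc 1 d) (hd : d ≠ 0) :
    lowered (d + 1) (insert (d + 1) S) = insert d S := by
  ext r
  have key : r ∈ S → 1 ≤ r ∧ r ≤ d := fun h => mem_Icc.1 (hS h)
  have key' : r + 1 ∈ S → r + 1 ≤ d := fun h => (mem_Icc.1 (hS h)).2
  simp only [mem_lowered, mem_insert]
  constructor
  · rintro ⟨h0, ⟨rfl | h, h'⟩ | ⟨h | h, h'⟩⟩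
    · omega
    · exact Or.inr h
    · left; omega
    · have := key' h; omega
  · rintro (rfl | h)
    · exact ⟨hd, Or.inr ⟨Or.inl rfl, le_rfl⟩⟩
    · have := key h
      exact ⟨by omega, Or.inl ⟨Or.inr h, by omega⟩⟩

theorem lowered_insert {d t : ℕ} {S : Finset ℕ} (hd : d ≠ 0) (ht : t ≤ d) :
    lowered t (insert (d + 1) S) = insert d (lowered t S) := by
  ext r
  simp only [mem_lowered, mem_insert]
  by_cases hr : r = d
  · subst hr
    simp only [hd, ne_eq, not_false_eq_true, true_and, true_or, iff_true]
    exact Or.inr (by omega)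
  · simp only [hr, false_or, Nat.add_right_cancel_iff]
    refine and_congr_right fun _ => or_congr ⟨?_, ?_⟩ Iff.rfl
    · rintro ⟨h | h, h'⟩
      · omega
      · exact ⟨h, h'⟩
    · rintro ⟨h, h'⟩
      exact ⟨Or.inr h, h'⟩

/-- The operator `u ↦ (S ↦ ∑ t ∈ S, u (lowered t S))`, which describes the effect of adding a
generic vector on the numbers of flags. -/
noncomputable def loweringOperator : (Finset ℕ → ℝ) →ₗ[ℝ] (Finset ℕ → ℝ) where
  toFun u S := ∑ t ∈ S, u (lowered t S)
  map_add' u v := by ext S; simp [sum_add_distrib]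
  map_smul' c u := by ext S; simp [mul_sum]

theorem loweringOperator_apply (u : Finset ℕ → ℝ) (S : Finset ℕ) :
    loweringOperator u S = ∑ t ∈ S, u (lowered t S) := rfl

/-- Each application of `loweringOperator` decreases the largest rank by one, so the operator is
nilpotent on functions of subsets of `{1, …, d}`. -/
theorem loweringOperator_pow_apply_eq_zero (u : Finset ℕ → ℝ) {m d : ℕ} (h : d < m)
    {S : Finset ℕ} (hS : S ⊆ Icc 1 d) : (loweringOperator ^ m) u S = 0 := by
  induction m generalizing d S with
  | zero => omega
  | succ m ih =>
    rw [pow_succ', Module.End.mul_apply, loweringOperator_apply]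
    refine sum_eq_zero fun t ht => ?_
    obtain _ | d := d
    · simpa using hS ht
    · exact ih (by omega) (lowered_subset_Icc hS ht)

/-- Among the functions `u` that ignore the top rank `d + 1`, one can prescribe how
`loweringOperator u` depends on the presence of `d + 1`. Going from `d` to `d + 1`, write
`u S = x S` and `u (S ∪ {d + 1}) = x S + y S` for `S ⊆ {1, …, d}`: eliminating `x` leaves for `y`
the same problem one rank lower. -/
theorem exists_loweringOperator_sub_eq (d : ℕ) (b : Finset ℕ → ℝ) :
    ∃ u : Finset ℕ → ℝ, (∀ S ⊆ Icc 1 d, u (insert (d + 1) S) = u S) ∧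
      ∀ S ⊆ Icc 1 d,
        loweringOperator u (insert (d + 1) S) - loweringOperator u S = b S := by
  induction d generalizing b with
  | zero =>
    refine ⟨fun _ => b ∅, fun _ _ => rfl, fun S hS => ?_⟩
    obtain rfl : S = ∅ := by simpa using hS
    simp [loweringOperator_apply]
  | succ d ih =>
    obtain ⟨y, -, hy⟩ := ih fun S => b (insert (d + 1) S) - b S
    let p : Finset ℕ → Finset ℕ := fun T => T.filter (· ≤ d)
    -- Given `y`, the formula is forced: on subsets of `{1, …, d}` one has `u S = x S` and
    -- `u (insert (d + 1) S) = x S + y S`, and the prescribed value at `S` reads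
    -- `x S + y S + loweringOperator y S = b S`.
    let u : Finset ℕ → ℝ := fun T =>
      b (p T) - loweringOperator y (p T) - if d + 1 ∈ T then 0 else y (p T)
    have hp : ∀ T k, d < k → p (insert k T) = p T := fun T k hk => by
      simp [p, filter_insert, hk]
    have hp' : ∀ T ⊆ Icc 1 d, p T = T := fun T hT =>
      filter_true_of_mem fun x hx => (mem_Icc.1 (hT hx)).2
    refine ⟨u, fun S _ => ?_, fun S hS => ?_⟩
    · simp only [u]
      rw [hp _ _ (by omega)]
      simp
    · have hn : d + 1 + 1 ∉ S := fun h => by simpa using hS h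
      have h1 : loweringOperator u (insert (d + 1 + 1) S) - loweringOperator u S
          = u (insert (d + 1) S) + loweringOperator y S := by
        rw [loweringOperator_apply, sum_insert hn, lowered_insert_self hS (by omega),
          loweringOperator_apply, loweringOperator_apply, add_sub_assoc, ← sum_sub_distrib]
        congr 1
        refine sum_congr rfl fun t ht => ?_
        have hsub := lowered_subset_Icc hS ht
        have hn' : d + 1 ∉ lowered t S := fun h => by simpa using hsub h
        rw [lowered_insert (by omega) (mem_Icc.1 (hS ht)).2]
        simp only [u]
        rw [hp _ _ (by omega), hp' _ hsub]
        simp [hn']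
      have h2 : u (insert (d + 1) S) = b (p S) - loweringOperator y (p S) := by
        simp only [u]
        rw [hp _ _ (by omega)]
        simp
      rw [h1, h2]
      have hpS : p S ⊆ Icc 1 d := fun x hx => by
        have hx' := mem_filter.1 hx
        exact mem_Icc.2 ⟨(mem_Icc.1 (hS hx'.1)).1, hx'.2⟩
      by_cases hd : d + 1 ∈ S
      · have hS' : S = insert (d + 1) (p S) := by
          ext x
          simp only [p, mem_insert, mem_filter]
          constructor
          · intro hx
            have := mem_Icc.1 (hS hx)
            by_cases h : x = d + 1
            · exact Or.inl h
            · exact Or.inr ⟨hx, by omega⟩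
          · rintro (rfl | h)
            · exact hd
            · exact h.1
        have := hy _ hpS
        rw [← hS'] at this
        linarith
      · have hS' : p S = S := hp' _ fun x hx => by
          have := mem_Icc.1 (hS hx)
          have : x ≠ d + 1 := fun h => hd (h ▸ hx)
          exact mem_Icc.2 (by omega)
        rw [hS']
        ring

/-! ### Lattices of spans and free extensions -/

section SpanLattice

variable {E : Type*} [AddCommGroup E] [Module ℝ E]

/-- The lattice of flats of the vector configuration `A`: all spans of subsets of `A`. -/
def spanLattice (A : Set E) : Set (Submodule ℝ E) :=
  {L | ∃ B ⊆ A, Submodule.span ℝ B = L}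

theorem finite_spanLattice {A : Set E} (hA : A.Finite) : (spanLattice A).Finite :=
  hA.finite_subsets.image (Submodule.span ℝ)

theorem spanLattice_mono {A A' : Set E} (h : A ⊆ A') : spanLattice A ⊆ spanLattice A' :=
  fun _ ⟨B, hB, hL⟩ => ⟨B, hB.trans h, hL⟩

theorem span_inter_mem_spanLattice (A : Set E) (L : Submodule ℝ E) :
    Submodule.span ℝ (A ∩ L) ∈ spanLattice A := ⟨_, Set.inter_subset_left, rfl⟩

theorem bot_mem_spanLattice (A : Set E) : ⊥ ∈ spanLattice A :=
  ⟨∅, Set.empty_subset A, Submodule.span_empty⟩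

theorem span_mem_spanLattice (A : Set E) : Submodule.span ℝ A ∈ spanLattice A :=
  ⟨A, subset_rfl, rfl⟩

theorem span_inter_le (A : Set E) (L : Submodule ℝ E) : Submodule.span ℝ (A ∩ L) ≤ L :=
  Submodule.span_le.2 Set.inter_subset_right

theorem le_span_inter {A : Set E} {G L : Submodule ℝ E} (hG : G ∈ spanLattice A) (h : G ≤ L) :
    G ≤ Submodule.span ℝ (A ∩ L) := by
  obtain ⟨B, hB, rfl⟩ := hG
  exact Submodule.span_mono fun b hb => ⟨hB hb, h (Submodule.subset_span hb)⟩

theorem span_inter_eq {A : Set E} {L : Submodule ℝ E} (hL : L ∈ spanLattice A) :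
    Submodule.span ℝ (A ∩ L) = L :=
  le_antisymm (span_inter_le A L) (le_span_inter hL le_rfl)

theorem sup_span_singleton_mem_spanLattice {A : Set E} {L : Submodule ℝ E} {e : E} (he : e ∈ A)
    (hL : L ∈ spanLattice A) : L ⊔ Submodule.span ℝ {e} ∈ spanLattice A := by
  obtain ⟨B, hB, rfl⟩ := hL
  exact ⟨B ∪ {e}, Set.union_subset hB (Set.singleton_subset_iff.2 he), Submodule.span_union _ _⟩

theorem mem_spanLattice_of_insert {A : Set E} {L : Submodule ℝ E} {e : E} (he : e ∉ L)
    (hL : L ∈ spanLattice (insert e A)) : L ∈ spanLattice A := by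
  obtain ⟨B, hB, rfl⟩ := hL
  exact ⟨B, fun b hb => (hB hb).resolve_left fun h => he (h ▸ Submodule.subset_span hb), rfl⟩

theorem span_inter_sup_span_singleton {A : Set E} {L : Submodule ℝ E} {e : E} (he : e ∈ L)
    (hL : L ∈ spanLattice (insert e A)) :
    Submodule.span ℝ (A ∩ L) ⊔ Submodule.span ℝ {e} = L := by
  refine le_antisymm (sup_le (span_inter_le A L) (by simpa using he)) ?_
  obtain ⟨B, hB, hBL⟩ := hL
  conv_lhs => rw [← hBL]
  rw [← Submodule.span_union]
  refine Submodule.span_mono fun b hb => ?_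
  rcases hB hb with rfl | h
  · exact Or.inr rfl
  · exact Or.inl ⟨h, hBL ▸ Submodule.subset_span hb⟩

/-- The flags of spans of subsets of `A` with rank set `S`, encoded as the functions `f` for which
`f s` is the member of dimension `s` for `s ∈ S`, and `f s = ⊥` for `s ∉ S`. -/
def flagSet (A : Set E) (S : Finset ℕ) : Set (ℕ → Submodule ℝ E) :=
  {f | (∀ s ∈ S, f s ∈ spanLattice A ∧ Module.finrank ℝ (f s) = s) ∧ (∀ s ∉ S, f s = ⊥) ∧
    ∀ s ∈ S, ∀ t ∈ S, s ≤ t → f s ≤ f t}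

theorem finite_flagSet {A : Set E} (hA : A.Finite) (S : Finset ℕ) : (flagSet A S).Finite := by
  have : Set.InjOn (fun (f : ℕ → Submodule ℝ E) (s : S) => f s) (flagSet A S) := by
    intro f hf g hg h
    ext1 s
    by_cases hs : s ∈ S
    · exact congrFun h ⟨s, hs⟩
    · rw [hf.2.1 s hs, hg.2.1 s hs]
  refine Set.Finite.of_finite_image ?_ this
  refine (Set.Finite.pi' fun _ : S => finite_spanLattice hA).subset ?_
  rintro _ ⟨f, hf, rfl⟩ s
  exact (hf.1 s s.2).1

/-- Adjoin `e` to the members of rank at least `t`: from a flag `g` of rank set `lowered t S` this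
produces a flag of rank set `S` whose members contain `e` from rank `t` on. -/
def insertFlag (e : E) (S : Finset ℕ) (t : ℕ) (g : ℕ → Submodule ℝ E) : ℕ → Submodule ℝ E :=
  fun s => if s ∈ S then if s < t then g s else g (s - 1) ⊔ Submodule.span ℝ {e} else ⊥

variable {A : Set E} {S : Finset ℕ} {e : E} {d t : ℕ}

theorem insertFlag_of_lt {g : ℕ → Submodule ℝ E} {s : ℕ} (hs : s ∈ S) (h : s < t) :
    insertFlag e S t g s = g s := by
  rw [insertFlag, if_pos hs, if_pos h]

theorem insertFlag_of_le {g : ℕ → Submodule ℝ E} {s : ℕ} (hs : s ∈ S) (h : t ≤ s) :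
    insertFlag e S t g s = g (s - 1) ⊔ Submodule.span ℝ {e} := by
  rw [insertFlag, if_pos hs, if_neg h.not_gt]

theorem flagSet_apply_of_zero_or {g : ℕ → Submodule ℝ E} (hg : g ∈ flagSet A S) {r : ℕ}
    (hr : r = 0 ∨ r ∈ S) : g r ∈ spanLattice A ∧ Module.finrank ℝ (g r) = r := by
  by_cases h : r ∈ S
  · exact hg.1 r h
  · obtain rfl := hr.resolve_right h
    rw [hg.2.1 _ h]
    exact ⟨bot_mem_spanLattice A, finrank_bot ℝ E⟩

theorem mem_lowered_of_lt {s : ℕ} (hS : S ⊆ Icc 1 d) (hs : s ∈ S) (h : s < t) :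
    s = 0 ∨ s ∈ lowered t S :=
  Or.inr (mem_lowered.2 ⟨by have := mem_Icc.1 (hS hs); omega, Or.inl ⟨hs, h⟩⟩)

theorem sub_one_mem_lowered {s : ℕ} (hS : S ⊆ Icc 1 d) (hs : s ∈ S) (h : t ≤ s) :
    s - 1 = 0 ∨ s - 1 ∈ lowered t S := by
  have := mem_Icc.1 (hS hs)
  refine or_iff_not_imp_left.2 fun h0 => mem_lowered.2 ⟨h0, Or.inr ?_⟩
  rw [Nat.sub_add_cancel this.1]
  exact ⟨hs, h⟩

variable [FiniteDimensional ℝ E]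

/-- If `e` is generic up to dimension `d`, a flat of dimension at most `d` through `e` loses
exactly one dimension when `e` is deleted from the configuration. -/
theorem finrank_span_inter_add_one {A : Set E} {L : Submodule ℝ E} {e : E} {d : ℕ}
    (hgen : ∀ F ∈ spanLattice A, Module.finrank ℝ F ≤ d → e ∉ F) (he : e ∈ L)
    (hL : L ∈ spanLattice (insert e A)) (hd : Module.finrank ℝ L ≤ d) :
    Module.finrank ℝ (Submodule.span ℝ (A ∩ L)) + 1 = Module.finrank ℝ L := by
  rw [← Submodule.finrank_sup_span_singleton, span_inter_sup_span_singleton he hL]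
  exact hgen _ (span_inter_mem_spanLattice A L)
    ((Submodule.finrank_mono (span_inter_le A L)).trans hd)

/-- If `e` is generic up to dimension `d`, joining `e` to a flat of dimension less than `d` brings
in no further vector of `A`: the flat is recovered from the join. -/
theorem span_inter_sup_eq {A : Set E} {G : Submodule ℝ E} {e : E} {d : ℕ}
    (hgen : ∀ F ∈ spanLattice A, Module.finrank ℝ F ≤ d → e ∉ F)
    (hG : G ∈ spanLattice A) (hd : Module.finrank ℝ G + 1 ≤ d) :
    Submodule.span ℝ (A ∩ (G ⊔ Submodule.span ℝ {e} : Submodule ℝ E)) = G := by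
  have hr := Submodule.finrank_sup_span_singleton (hgen G hG (by omega))
  have h := finrank_span_inter_add_one hgen
    (le_sup_right (a := G) (Submodule.mem_span_singleton_self e))
    (sup_span_singleton_mem_spanLattice (Set.mem_insert e A)
      (spanLattice_mono (Set.subset_insert e A) hG)) (hr.trans_le hd)
  exact (Submodule.eq_of_le_of_finrank_eq (le_span_inter hG le_sup_left) (by omega)).symm

theorem flagSet_mono {g : ℕ → Submodule ℝ E} (hg : g ∈ flagSet A S) {r r' : ℕ}
    (hr : r = 0 ∨ r ∈ S) (hr' : r' = 0 ∨ r' ∈ S) (h : r ≤ r') : g r ≤ g r' := by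
  rcases Nat.eq_zero_or_pos r with rfl | h0
  · rw [Submodule.finrank_eq_zero.1 (flagSet_apply_of_zero_or hg hr).2]
    exact bot_le
  · exact hg.2.2 r (hr.resolve_left (by omega)) r' (hr'.resolve_left (by omega)) h

variable (hS : S ⊆ Icc 1 d) (hgen : ∀ F ∈ spanLattice A, Module.finrank ℝ F ≤ d → e ∉ F)
include hS hgen

omit [FiniteDimensional ℝ E] in
theorem mem_insertFlag_iff {g : ℕ → Submodule ℝ E} (hg : g ∈ flagSet A (lowered t S)) {s : ℕ}
    (hs : s ∈ S) : e ∈ insertFlag e S t g s ↔ t ≤ s := by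
  rcases lt_or_ge s t with h | h
  · rw [insertFlag_of_lt hs h]
    have := flagSet_apply_of_zero_or hg (mem_lowered_of_lt hS hs h)
    exact iff_of_false (hgen _ this.1 (this.2.trans_le (mem_Icc.1 (hS hs)).2)) h.not_ge
  · rw [insertFlag_of_le hs h]
    simpa [h] using Submodule.mem_sup_right (Submodule.mem_span_singleton_self e)

theorem insertFlag_mem_flagSet {g : ℕ → Submodule ℝ E} (hg : g ∈ flagSet A (lowered t S)) :
    insertFlag e S t g ∈ flagSet (insert e A) S := by
  refine ⟨fun s hs => ?_, fun s hs => if_neg hs, fun s hs s' hs' hss => ?_⟩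
  · have hs1 := mem_Icc.1 (hS hs)
    rcases lt_or_ge s t with h | h
    · rw [insertFlag_of_lt hs h]
      have := flagSet_apply_of_zero_or hg (mem_lowered_of_lt hS hs h)
      exact ⟨spanLattice_mono (Set.subset_insert e A) this.1, this.2⟩
    · rw [insertFlag_of_le hs h]
      have := flagSet_apply_of_zero_or hg (sub_one_mem_lowered hS hs h)
      refine ⟨sup_span_singleton_mem_spanLattice (Set.mem_insert e A)
        (spanLattice_mono (Set.subset_insert e A) this.1), ?_⟩
      rw [Submodule.finrank_sup_span_singleton (hgen _ this.1 (by omega)), this.2]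
      omega
  · rcases lt_or_ge s t with h | h <;> rcases lt_or_ge s' t with h' | h'
    · rw [insertFlag_of_lt hs h, insertFlag_of_lt hs' h']
      exact flagSet_mono hg (mem_lowered_of_lt hS hs h) (mem_lowered_of_lt hS hs' h') hss
    · rw [insertFlag_of_lt hs h, insertFlag_of_le hs' h']
      exact (flagSet_mono hg (mem_lowered_of_lt hS hs h) (sub_one_mem_lowered hS hs' h')
        (by omega)).trans le_sup_left
    · omega
    · rw [insertFlag_of_le hs h, insertFlag_of_le hs' h']
      exact sup_le_sup_right (flagSet_mono hg (sub_one_mem_lowered hS hs h)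
        (sub_one_mem_lowered hS hs' h') (by omega)) _

theorem insertFlag_injOn : Set.InjOn (insertFlag e S t) (flagSet A (lowered t S)) := by
  intro g hg g' hg' h
  ext1 r
  by_cases hr : r ∈ lowered t S
  · obtain ⟨-, ⟨hr', ht⟩ | ⟨hr', ht⟩⟩ := mem_lowered.1 hr
    · have := congrFun h r
      rwa [insertFlag_of_lt hr' ht, insertFlag_of_lt hr' ht] at this
    · have := congrFun h (r + 1)
      rw [insertFlag_of_le hr' ht, insertFlag_of_le hr' ht, Nat.add_sub_cancel] at this
      have hd := (mem_Icc.1 (hS hr')).2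
      have hgr := hg.1 r hr
      have hgr' := hg'.1 r hr
      rw [← span_inter_sup_eq hgen hgr.1 (by omega), this,
        span_inter_sup_eq hgen hgr'.1 (by omega)]
  · rw [hg.2.1 r hr, hg'.2.1 r hr]

/-- A flag of `insert e A` whose first member containing `e` has rank `t` comes from a flag of `A`
with rank set `lowered t S`, obtained by deleting `e`. -/
theorem exists_insertFlag_eq {f : ℕ → Submodule ℝ E} (hf : f ∈ flagSet (insert e A) S)
    (ht : t ∈ S) (hlt : ∀ s ∈ S, s < t → e ∉ f s) (het : e ∈ f t) :
    ∃ g ∈ flagSet A (lowered t S), insertFlag e S t g = f := by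
  have hrank : ∀ s ∈ S, t ≤ s → Module.finrank ℝ (Submodule.span ℝ (A ∩ f s)) + 1 = s :=
    fun s hs h => (finrank_span_inter_add_one hgen (hf.2.2 t ht s hs h het) (hf.1 s hs).1
      ((hf.1 s hs).2.trans_le (mem_Icc.1 (hS hs)).2)).trans (hf.1 s hs).2
  have hlow : ∀ s ∈ S, s < t → f s ∈ spanLattice A := fun s hs h =>
    mem_spanLattice_of_insert (hlt s hs h) (hf.1 s hs).1
  classical
  let g : ℕ → Submodule ℝ E := fun r => if r ∈ lowered t S then
    if r < t ∧ r ∈ S then f r else Submodule.span ℝ (A ∩ f (r + 1)) else ⊥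
  have hg1 : ∀ r ∈ S, r < t → g r = f r := fun r hr h => by
    simp only [g]
    rw [if_pos, if_pos ⟨h, hr⟩]
    exact mem_lowered.2 ⟨by have := mem_Icc.1 (hS hr); omega, Or.inl ⟨hr, h⟩⟩
  -- The two descriptions of `g r` agree when both `r` and `t = r + 1` belong to `S`.
  have hg2 : ∀ r, r + 1 ∈ S → t ≤ r + 1 → g r = Submodule.span ℝ (A ∩ f (r + 1)) := by
    intro r hr h
    have hk := hrank _ hr h
    by_cases hrS : r < t ∧ r ∈ S
    · rw [hg1 r hrS.2 hrS.1]
      refine Submodule.eq_of_le_of_finrank_eq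
        (le_span_inter (hlow r hrS.2 hrS.1) (hf.2.2 _ hrS.2 _ hr (by omega))) ?_
      have := (hf.1 r hrS.2).2
      omega
    · by_cases hr0 : r = 0
      · subst hr0
        rw [Submodule.finrank_eq_zero.1 (by omega : Module.finrank ℝ
          (Submodule.span ℝ (A ∩ f (0 + 1))) = 0)]
        exact if_neg fun h => (mem_lowered.1 h).1 rfl
      · simp only [g]
        rw [if_pos (mem_lowered.2 ⟨hr0, Or.inr ⟨hr, h⟩⟩), if_neg hrS]
  refine ⟨g, ⟨fun r hr => ?_, fun r hr => if_neg hr, fun r hr r' hr' hrr => ?_⟩, ?_⟩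
  · obtain ⟨-, ⟨h, h'⟩ | ⟨h, h'⟩⟩ := mem_lowered.1 hr
    · rw [hg1 r h h']
      exact ⟨hlow r h h', (hf.1 r h).2⟩
    · rw [hg2 r h h']
      exact ⟨span_inter_mem_spanLattice A _, by have := hrank _ h h'; omega⟩
  · obtain ⟨-, ⟨h, ht1⟩ | ⟨h, ht1⟩⟩ := mem_lowered.1 hr <;>
    obtain ⟨-, ⟨h', ht2⟩ | ⟨h', ht2⟩⟩ := mem_lowered.1 hr'
    · rw [hg1 r h ht1, hg1 r' h' ht2]
      exact hf.2.2 r h r' h' hrr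
    · rw [hg1 r h ht1, hg2 r' h' ht2]
      exact le_span_inter (hlow r h ht1) (hf.2.2 r h _ h' (by omega))
    · obtain rfl : r = r' := by omega
      exact le_rfl
    · rw [hg2 r h ht1, hg2 r' h' ht2]
      exact Submodule.span_mono (Set.inter_subset_inter_right A (hf.2.2 _ h _ h' (by omega)))
  · ext1 s
    by_cases hs : s ∈ S
    · have hs1 := mem_Icc.1 (hS hs)
      rcases lt_or_ge s t with h | h
      · rw [insertFlag_of_lt hs h, hg1 s hs h]
      · obtain ⟨r, rfl⟩ : ∃ r, s = r + 1 := ⟨s - 1, by omega⟩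
        rw [insertFlag_of_le hs h, Nat.add_sub_cancel, hg2 r hs h]
        exact span_inter_sup_span_singleton (hf.2.2 t ht _ hs h het) (hf.1 _ hs).1
    · rw [hf.2.1 s hs]
      exact if_neg hs

theorem flagSet_insert :
    flagSet (insert e A) S =
      flagSet A S ∪ ⋃ t ∈ S, insertFlag e S t '' flagSet A (lowered t S) := by
  apply Set.Subset.antisymm
  · intro f hf
    by_cases h : ∃ t, t ∈ S ∧ e ∈ f t
    · classical
      obtain ⟨ht, het⟩ := Nat.find_spec h
      refine Or.inr (Set.mem_biUnion ht (exists_insertFlag_eq hS hgen hf ht ?_ het))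
      exact fun s hs hst he => Nat.find_min h hst ⟨hs, he⟩
    · push Not at h
      exact Or.inl ⟨fun s hs => ⟨mem_spanLattice_of_insert (h s hs) (hf.1 s hs).1, (hf.1 s hs).2⟩,
        hf.2⟩
  · refine Set.union_subset (fun f hf => ⟨fun s hs =>
      ⟨spanLattice_mono (Set.subset_insert e A) (hf.1 s hs).1, (hf.1 s hs).2⟩, hf.2⟩) ?_
    refine Set.iUnion₂_subset fun t _ => ?_
    rintro _ ⟨g, hg, rfl⟩
    exact insertFlag_mem_flagSet hS hgen hg

/-- Number of flags of a free extension: flags are sorted by the rank `t` of their first member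
that contains the new vector, if there is one. -/
theorem ncard_flagSet_insert (hA : A.Finite) :
    (flagSet (insert e A) S).ncard =
      (flagSet A S).ncard + ∑ t ∈ S, (flagSet A (lowered t S)).ncard := by
  classical
  have hfin : ∀ t, (insertFlag e S t '' flagSet A (lowered t S)).Finite := fun t =>
    (finite_flagSet hA _).image _
  have this : (⋃ t ∈ S, insertFlag e S t '' flagSet A (lowered t S)) =
      ((S.biUnion fun t => (hfin t).toFinset : Finset (ℕ → Submodule ℝ E)) : Set _) := by
    ext; simp
  rw [flagSet_insert hS hgen, Set.ncard_union_eq ?_ (finite_flagSet hA S)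
    (this ▸ Finset.finite_toSet _)]
  · congr 1
    rw [this, Set.ncard_coe_finset, card_biUnion]
    · refine sum_congr rfl fun t _ => ?_
      rw [← Set.ncard_eq_toFinset_card _ (hfin t), (insertFlag_injOn hS hgen).ncard_image]
    · intro t ht t' ht' hne
      rw [Function.onFun, Finset.disjoint_left]
      intro f hf hf'
      obtain ⟨g, hg, rfl⟩ := (Set.Finite.mem_toFinset _).1 hf
      obtain ⟨g', hg', h⟩ := (Set.Finite.mem_toFinset _).1 hf'
      have key : ∀ s ∈ S, t ≤ s ↔ t' ≤ s := fun s hs => by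
        rw [← mem_insertFlag_iff hS hgen hg hs, ← h, mem_insertFlag_iff hS hgen hg' hs]
      exact hne (le_antisymm ((key t' ht').2 le_rfl) ((key t ht).1 le_rfl))
  · rw [Set.disjoint_left]
    intro f hf hf'
    obtain ⟨t, ht, g, hg, rfl⟩ := Set.mem_iUnion₂.1 hf'
    have h1 := (mem_insertFlag_iff hS hgen hg ht).2 le_rfl
    have h2 := hf.1 t ht
    exact hgen _ h2.1 (h2.2.trans_le (mem_Icc.1 (hS ht)).2) h1

end SpanLattice

/-! ### The linear span of the flag counts -/

section FlagSpan

variable {E : Type*} [AddCommGroup E] [Module ℝ E]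

/-- The number of flags of spans of subsets of `A` with rank set `S`. -/
noncomputable def flagCount (A : Set E) (S : Finset ℕ) : ℝ := (flagSet A S).ncard

theorem flagCount_empty (A : Set E) : flagCount A ∅ = 1 := by
  have : flagSet A ∅ = {fun _ => ⊥} := by
    ext f
    simp [flagSet, funext_iff]
  simp [flagCount, this]

theorem le_span_of_mem_spanLattice {A : Set E} {L : Submodule ℝ E} (hL : L ∈ spanLattice A) :
    L ≤ Submodule.span ℝ A := by
  obtain ⟨B, hB, rfl⟩ := hL
  exact Submodule.span_mono hB

/-- A subspace is not covered by finitely many subspaces that do not contain it. -/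
theorem exists_mem_forall_notMem (W : Submodule ℝ E) {s : Set (Submodule ℝ E)} (hs : s.Finite)
    (h : ∀ F ∈ s, ¬ W ≤ F) : ∃ e ∈ W, ∀ F ∈ s, e ∉ F := by
  have := hs.to_subtype
  obtain ⟨x, hx⟩ := Submodule.exists_forall_notMem_of_forall_ne_top
    (fun F : s => F.1.comap W.subtype)
    fun F hF => h F F.2 (by simpa [Submodule.comap_subtype_eq_top] using hF)
  exact ⟨x, x.2, fun F hF => hx ⟨F, hF⟩⟩

variable (E) in
/-- The span of the flag counts of the finite configurations of nonzero vectors of rank `d + 1` in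
`E`. Functions that vanish on all subsets of `{1, …, d}` are added, so that only the values on
these subsets matter for membership. -/
def flagSpan (d : ℕ) : Submodule ℝ (Finset ℕ → ℝ) :=
  Submodule.span ℝ ({v | ∃ A : Set E, A.Finite ∧ 0 ∉ A ∧
      Module.finrank ℝ (Submodule.span ℝ A) = d + 1 ∧ v = flagCount A} ∪
    {v | ∀ S ⊆ Icc 1 d, v S = 0})

theorem mem_flagSpan_congr {d : ℕ} {v w : Finset ℕ → ℝ} (hv : v ∈ flagSpan E d)
    (h : ∀ S ⊆ Icc 1 d, w S = v S) : w ∈ flagSpan E d := by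
  rw [← sub_add_cancel w v]
  refine add_mem (Submodule.subset_span (Or.inr fun S hS => ?_)) hv
  simp [h S hS]

theorem flagCount_mem_flagSpan {d : ℕ} {A : Set E} (hA : A.Finite) (h0 : 0 ∉ A)
    (hd : Module.finrank ℝ (Submodule.span ℝ A) = d + 1) : flagCount A ∈ flagSpan E d :=
  Submodule.subset_span (Or.inl ⟨A, hA, h0, hd, rfl⟩)

variable [FiniteDimensional ℝ E]

theorem flagCount_insert {A : Set E} (hA : A.Finite) {S : Finset ℕ} {e : E} {d : ℕ}
    (hgen : ∀ F ∈ spanLattice A, Module.finrank ℝ F ≤ d → e ∉ F) (hS : S ⊆ Icc 1 d) :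
    flagCount (insert e A) S = flagCount A S + loweringOperator (flagCount A) S := by
  simp only [flagCount, loweringOperator_apply, ncard_flagSet_insert hS hgen hA]
  push_cast
  rfl

/-- The full span is the only flat of maximal rank, so this rank can be added to a rank set for
free. -/
theorem flagCount_insert_finrank {A : Set E} {r : ℕ} {S : Finset ℕ}
    (hr : Module.finrank ℝ (Submodule.span ℝ A) = r) (hS : ∀ s ∈ S, s < r) :
    flagCount A (insert r S) = flagCount A S := by
  have hrS : r ∉ S := fun h => (hS r h).false
  have key : flagSet A (insert r S) =
      (fun f => Function.update f r (Submodule.span ℝ A)) '' flagSet A S := by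
    ext f
    constructor
    · intro hf
      have hfr : f r = Submodule.span ℝ A := by
        have := hf.1 r (mem_insert_self r S)
        exact Submodule.eq_of_le_of_finrank_eq (le_span_of_mem_spanLattice this.1)
          (this.2.trans hr.symm)
      refine ⟨Function.update f r ⊥, ⟨fun s hs => ?_, fun s hs => ?_, fun s hs t ht hst => ?_⟩,
        ?_⟩
      · rw [Function.update_of_ne (hS s hs).ne]
        exact hf.1 s (mem_insert_of_mem hs)
      · by_cases h : s = r
        · simp [h]
        · rw [Function.update_of_ne h]
          exact hf.2.1 s (by simp [h, hs])
      · rw [Function.update_of_ne (hS s hs).ne, Function.update_of_ne (hS t ht).ne]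
        exact hf.2.2 s (mem_insert_of_mem hs) t (mem_insert_of_mem ht) hst
      · simp [← hfr]
    · rintro ⟨f, hf, rfl⟩
      refine ⟨fun s hs => ?_, fun s hs => ?_, fun s hs t ht hst => ?_⟩
      · beta_reduce
        rcases mem_insert.1 hs with rfl | h
        · rw [Function.update_self]
          exact ⟨span_mem_spanLattice A, hr⟩
        · rw [Function.update_of_ne (hS s h).ne]
          exact hf.1 s h
      · have : s ≠ r ∧ s ∉ S := by simpa using hs
        simpa [Function.update_of_ne this.1] using hf.2.1 s this.2
      · rcases mem_insert.1 ht with rfl | h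
        · rcases mem_insert.1 hs with rfl | h'
          · exact le_rfl
          · simpa [Function.update_of_ne (hS s h').ne] using
              le_span_of_mem_spanLattice (hf.1 s h').1
        · rcases mem_insert.1 hs with rfl | h'
          · exact absurd (hS t h) hst.not_gt
          · simpa [Function.update_of_ne (hS s h').ne, Function.update_of_ne (hS t h).ne] using
              hf.2.2 s h' t h hst
  rw [flagCount, key, Set.InjOn.ncard_image, flagCount]
  intro f hf g hg h
  ext1 s
  by_cases hs : s = r
  · rw [hs, hf.2.1 r hrS, hg.2.1 r hrS]
  · simpa [hs] using congrFun h s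

/-- Adding a vector in general position within the span of a configuration keeps its rank and
changes the flag counts by `loweringOperator`. -/
theorem loweringOperator_mem_flagSpan {d : ℕ} {v : Finset ℕ → ℝ} (hv : v ∈ flagSpan E d) :
    loweringOperator v ∈ flagSpan E d := by
  induction hv using Submodule.span_induction with
  | mem v hv =>
    rcases hv with ⟨A, hA, h0, hd, rfl⟩ | hv
    · obtain ⟨e, he, hgen⟩ := exists_mem_forall_notMem (Submodule.span ℝ A)
        (s := {F ∈ spanLattice A | Module.finrank ℝ F ≤ d})
        ((finite_spanLattice hA).subset (Set.sep_subset _ _)) fun F hF hle => by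
          have := Submodule.finrank_mono hle
          have := hF.2
          omega
      replace hgen : ∀ F ∈ spanLattice A, Module.finrank ℝ F ≤ d → e ∉ F :=
        fun F hF hFd => hgen F ⟨hF, hFd⟩
      have he0 : e ≠ 0 := fun h =>
        hgen ⊥ (bot_mem_spanLattice A) (by simp) (by simpa using h)
      have h1 : flagCount (insert e A) ∈ flagSpan E d :=
        flagCount_mem_flagSpan (hA.insert e) (by simp [h0, he0.symm])
          (by rw [Submodule.span_insert_eq_span he, hd])
      refine mem_flagSpan_congr (sub_mem h1 (flagCount_mem_flagSpan hA h0 hd)) fun S hS => ?_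
      simp [flagCount_insert hA hgen hS]
    · refine Submodule.subset_span (Or.inr fun S hS => ?_)
      rw [loweringOperator_apply]
      exact sum_eq_zero fun t ht => hv _
        (lowered_subset_Icc (hS.trans (Icc_subset_Icc_right d.le_succ)) ht)
  | zero => simp
  | add v w _ _ hv hw => simpa using add_mem hv hw
  | smul c v _ hv => simpa using Submodule.smul_mem _ c hv

/-- Since `loweringOperator` is nilpotent modulo `flagSpan E d` and preserves it,
`1 + loweringOperator` is injective modulo `flagSpan E d`. -/
theorem mem_flagSpan_of_add_loweringOperator_mem {d : ℕ} {v : Finset ℕ → ℝ}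
    (hv : v + loweringOperator v ∈ flagSpan E d) : v ∈ flagSpan E d := by
  have hpow : ∀ m, ∀ w ∈ flagSpan E d, (loweringOperator ^ m) w ∈ flagSpan E d := fun m w hw => by
    induction m with
    | zero => simpa using hw
    | succ m ih =>
      rw [pow_succ', Module.End.mul_apply]
      exact loweringOperator_mem_flagSpan ih
  have key : ∀ k ≤ d + 1, (loweringOperator ^ (d + 1 - k)) v ∈ flagSpan E d := fun k hk => by
    induction k with
    | zero =>
      exact Submodule.subset_span (Or.inr fun S hS =>
        loweringOperator_pow_apply_eq_zero v d.lt_succ_self hS)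
    | succ k ih =>
      have h1 := hpow (d + 1 - (k + 1)) _ hv
      have h2 := ih (by omega)
      rw [show d + 1 - k = d + 1 - (k + 1) + 1 by omega, pow_succ, Module.End.mul_apply] at h2
      rw [map_add] at h1
      simpa using sub_mem h1 h2
  simpa using key (d + 1) le_rfl

/-- Configurations of rank one less also have their flag counts in `flagSpan E d`: add a vector
outside their span, then undo `1 + loweringOperator`. -/
theorem flagCount_mem_flagSpan_of_finrank_eq {d : ℕ} (hdE : d + 1 ≤ Module.finrank ℝ E)
    {A : Set E} (hA : A.Finite) (h0 : 0 ∉ A)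
    (hd : Module.finrank ℝ (Submodule.span ℝ A) = d) : flagCount A ∈ flagSpan E d := by
  have hne : Submodule.span ℝ A ≠ ⊤ := fun h => by
    rw [h, finrank_top] at hd
    omega
  obtain ⟨e, -, he⟩ := SetLike.exists_of_lt hne.lt_top
  have he0 : e ≠ 0 := fun h => he (h ▸ zero_mem _)
  refine mem_flagSpan_of_add_loweringOperator_mem (mem_flagSpan_congr
    (flagCount_mem_flagSpan (hA.insert e) (by simp [h0, he0.symm]) ?_) fun S hS =>
      (flagCount_insert hA (fun F hF _ h => he (le_span_of_mem_spanLattice hF h)) hS).symm)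
  rw [Submodule.span_insert, sup_comm, Submodule.finrank_sup_span_singleton he, hd]

theorem mem_flagSpan_of_insert_eq {d : ℕ} (hdE : d + 2 ≤ Module.finrank ℝ E)
    (htop : flagSpan E d = ⊤) {v : Finset ℕ → ℝ}
    (hv : ∀ S ⊆ Icc 1 d, v (insert (d + 1) S) = v S) : v ∈ flagSpan E (d + 1) := by
  have hsub : ∀ S ⊆ Icc 1 (d + 1), S.erase (d + 1) ⊆ Icc 1 d := fun S hS s hs => by
    have := mem_Icc.1 (hS (mem_of_mem_erase hs))
    have := ne_of_mem_erase hs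
    exact mem_Icc.2 (by omega)
  have key : ∀ w ∈ flagSpan E d, (fun S => w (S.erase (d + 1))) ∈ flagSpan E (d + 1) := by
    intro w hw
    induction hw using Submodule.span_induction with
    | mem w hw =>
      rcases hw with ⟨A, hA, h0, hd, rfl⟩ | hw
      · refine mem_flagSpan_congr (flagCount_mem_flagSpan_of_finrank_eq hdE hA h0 hd)
          fun S hS => ?_
        by_cases h : d + 1 ∈ S
        · conv_rhs => rw [← insert_erase h]
          exact (flagCount_insert_finrank hd fun s hs =>
            Nat.lt_succ_of_le (mem_Icc.1 (hsub S hS hs)).2).symm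
        · rw [erase_eq_of_notMem h]
      · exact Submodule.subset_span (Or.inr fun S hS => hw _ (hsub S hS))
    | zero => exact zero_mem _
    | add v w _ _ hv hw => exact add_mem hv hw
    | smul c v _ hv => exact Submodule.smul_mem _ c hv
  refine mem_flagSpan_congr (key v (htop ▸ Submodule.mem_top)) fun S hS => ?_
  by_cases h : d + 1 ∈ S
  · conv_lhs => rw [← insert_erase h]
    exact hv _ (hsub S hS)
  · rw [erase_eq_of_notMem h]

theorem flagSpan_eq_top {d : ℕ} (hdE : d + 1 ≤ Module.finrank ℝ E) : flagSpan E d = ⊤ := by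
  induction d with
  | zero =>
    have : Nontrivial E := Module.nontrivial_of_finrank_pos (R := ℝ) (by omega)
    obtain ⟨e, he⟩ := exists_ne (0 : E)
    refine eq_top_iff.2 fun v _ => mem_flagSpan_congr (Submodule.smul_mem _ (v ∅)
      (flagCount_mem_flagSpan (Set.finite_singleton e) (by simp [he.symm])
        (finrank_span_singleton he))) fun S hS => ?_
    obtain rfl : S = ∅ := by simpa using hS
    simp [flagCount_empty]
  | succ d ih =>
    have htop := ih (by omega)
    refine eq_top_iff.2 fun v _ => ?_
    obtain ⟨u, hu, huv⟩ := exists_loweringOperator_sub_eq d fun S => v (insert (d + 1) S) - v S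
    rw [← sub_add_cancel v (loweringOperator u)]
    refine add_mem (mem_flagSpan_of_insert_eq hdE htop fun S hS => ?_)
      (loweringOperator_mem_flagSpan (mem_flagSpan_of_insert_eq hdE htop hu))
    have := huv S hS
    simp only [Pi.sub_apply]
    linarith

end FlagSpan

/-! ### Lattices of spans as graded posets -/

/-- In a finite graded poset whose minimal elements have grade `0`, the grade is the length of a
longest chain below an element. -/
theorem height_eq_grade {α : Type*} [PartialOrder α] [Finite α] [GradeMinOrder ℕ α] (a : α) :
    Order.height a = grade ℕ a := by
  refine le_antisymm ?_ ?_
  · have := Order.height_le_height_apply_of_strictMono (grade ℕ : α → ℕ) grade_strictMono a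
    simpa using this
  · induction hn : grade ℕ a generalizing a with
    | zero => simp
    | succ n ih =>
      have hmin : ¬ IsMin a := fun h => by
        have := (h.grade ℕ).eq_bot
        rw [hn] at this
        exact absurd this n.succ_ne_zero
      obtain ⟨y, hy⟩ := not_isMin_iff.1 hmin
      obtain ⟨x, -, hx⟩ := exists_le_covBy_of_lt hy
      have hg := Order.covBy_iff_add_one_eq.1 (hx.grade ℕ)
      have h1 := ih x (by omega)
      push_cast
      exact (add_le_add_left h1 1).trans (Order.height_add_one_le hx.lt)

section SpanLattice

variable {E : Type*} [AddCommGroup E] [Module ℝ E]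

/-- The spans of subsets of `A` have `⊥ = span ∅` and `⊤ = span A`. -/
@[reducible]
def spanLatticeBoundedOrder (A : Set E) : BoundedOrder (spanLattice A) where
  top := ⟨_, span_mem_spanLattice A⟩
  le_top F := le_span_of_mem_spanLattice F.2
  bot := ⟨_, bot_mem_spanLattice A⟩
  bot_le _ := bot_le (α := Submodule ℝ E)

variable [FiniteDimensional ℝ E]

theorem finrank_eq_of_covBy {A : Set E} {G F : spanLattice A} (h : G ⋖ F) :
    Module.finrank ℝ G.1 + 1 = Module.finrank ℝ F.1 := by
  obtain ⟨e, heA, heG⟩ : ∃ e ∈ A ∩ F.1, e ∉ G.1 := by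
    by_contra! hle
    refine h.lt.not_ge ?_
    have : Submodule.span ℝ (A ∩ F.1) ≤ G.1 := Submodule.span_le.2 hle
    rwa [span_inter_eq F.2] at this
  let G' : spanLattice A := ⟨_, sup_span_singleton_mem_spanLattice heA.1 G.2⟩
  have h1 : G < G' := lt_of_le_of_ne (le_sup_left (a := G.1)) fun hG => heG <| by
    rw [hG]
    exact le_sup_right (a := G.1) (Submodule.mem_span_singleton_self e)
  have h2 : G' ≤ F := sup_le (a := G.1) h.le (by simpa using heA.2)
  have h3 : G' = F := (h.eq_or_eq h1.le h2).resolve_left h1.ne'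
  rw [← h3]
  exact (Submodule.finrank_sup_span_singleton heG).symm

/-- The spans of subsets of `A` are graded by dimension. -/
@[reducible]
noncomputable def spanLatticeGradeMinOrder (A : Set E) : GradeMinOrder ℕ (spanLattice A) where
  grade F := Module.finrank ℝ F.1
  grade_strictMono _ _ h := Submodule.finrank_lt_finrank_of_lt h
  covBy_grade _ _ h := Order.covBy_iff_add_one_eq.2 (finrank_eq_of_covBy h)
  isMin_grade F h := by
    have h' : (⟨⊥, bot_mem_spanLattice A⟩ : spanLattice A) = F :=
      h.eq_of_le (bot_le (α := Submodule ℝ E))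
    rw [← h', finrank_bot]
    exact isMin_bot

theorem height_spanLattice {A : Set E} (hA : A.Finite) (F : spanLattice A) :
    Order.height F = Module.finrank ℝ F.1 := by
  have := (finite_spanLattice hA).to_subtype
  let _ := spanLatticeGradeMinOrder A
  exact height_eq_grade F

/-- A chain is determined by listing its members by dimension. -/
theorem flagWhitney_spanLattice {A : Set E} (hA : A.Finite) (S : Finset ℕ) :
    flagWhitney (spanLattice A) S = (flagSet A S).ncard := by
  let Φ : (ℕ → Submodule ℝ E) → Set (spanLattice A) := fun f => {F | ∃ s ∈ S, F.1 = f s}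
  have hinj : Set.InjOn Φ (flagSet A S) := by
    intro f hf g hg h
    ext1 s
    by_cases hs : s ∈ S
    · have hmem : (⟨f s, (hf.1 s hs).1⟩ : spanLattice A) ∈ Φ g := h ▸ ⟨s, hs, rfl⟩
      obtain ⟨t, ht, hft⟩ := hmem
      change f s = g t at hft
      have := congrArg (fun L : Submodule ℝ E => Module.finrank ℝ L) hft
      beta_reduce at this
      rw [(hf.1 s hs).2, (hg.1 t ht).2] at this
      rw [hft, this]
    · rw [hf.2.1 s hs, hg.2.1 s hs]
  rw [flagWhitney, ← hinj.ncard_image]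
  congr 1
  ext c
  constructor
  · rintro ⟨hc, hr⟩
    have heq : ∀ F ∈ c, ∀ G ∈ c, Module.finrank ℝ F.1 = Module.finrank ℝ G.1 → F = G := by
      intro F hF G hG h
      rcases hc.total hF hG with hle | hle
      · exact Subtype.ext (Submodule.eq_of_le_of_finrank_eq hle h)
      · exact (Subtype.ext (Submodule.eq_of_le_of_finrank_eq hle h.symm)).symm
    have hex : ∀ s ∈ S, ∃ F ∈ c, Module.finrank ℝ F.1 = s := fun s hs => by
      obtain ⟨F, hF, h⟩ : (s : ℕ∞) ∈ (fun a : spanLattice A => Order.height a) '' c :=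
        hr ▸ ⟨s, hs, rfl⟩
      refine ⟨F, hF, ?_⟩
      beta_reduce at h
      rw [height_spanLattice hA] at h
      exact_mod_cast h
    have : Nonempty (spanLattice A) := ⟨⟨⊥, bot_mem_spanLattice A⟩⟩
    choose! g hgc hgr using hex
    let f : ℕ → Submodule ℝ E := fun s => if s ∈ S then (g s).1 else ⊥
    have hf : ∀ s ∈ S, f s = (g s).1 := fun s hs => if_pos hs
    refine ⟨f, ⟨fun s hs => ?_, fun s hs => if_neg hs, fun s hs t ht hst => ?_⟩, ?_⟩
    · rw [hf s hs]
      exact ⟨(g s).2, hgr s hs⟩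
    · rw [hf s hs, hf t ht]
      rcases hc.total (hgc s hs) (hgc t ht) with hle | hle
      · exact hle
      · have := Submodule.finrank_mono hle
        rw [hgr s hs, hgr t ht] at this
        rw [le_antisymm hst this]
    · ext F
      constructor
      · rintro ⟨s, hs, h⟩
        rw [hf s hs] at h
        rw [Subtype.ext h]
        exact hgc s hs
      · intro hF
        obtain ⟨s, hs, h⟩ : Order.height F ∈ (fun s : ℕ => (s : ℕ∞)) '' S := hr ▸ ⟨F, hF, rfl⟩
        beta_reduce at h
        rw [height_spanLattice hA] at h
        have h' : s = Module.finrank ℝ F.1 := by exact_mod_cast h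
        refine ⟨s, hs, ?_⟩
        rw [hf s hs, heq F hF (g s) (hgc s hs) (h'.symm.trans (hgr s hs).symm)]
  · rintro ⟨f, hf, rfl⟩
    refine ⟨?_, ?_⟩
    · rintro F ⟨s, hs, hF⟩ G ⟨t, ht, hG⟩ -
      rcases le_total s t with h | h
      · exact Or.inl (Subtype.coe_le_coe.1 (hF ▸ hG ▸ hf.2.2 s hs t ht h))
      · exact Or.inr (Subtype.coe_le_coe.1 (hF ▸ hG ▸ hf.2.2 t ht s hs h))
    · ext r
      constructor
      · rintro ⟨F, ⟨s, hs, hF⟩, rfl⟩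
        refine ⟨s, hs, ?_⟩
        beta_reduce
        rw [height_spanLattice hA, hF, (hf.1 s hs).2]
      · rintro ⟨s, hs, rfl⟩
        refine ⟨⟨f s, (hf.1 s hs).1⟩, ⟨s, hs, rfl⟩, ?_⟩
        beta_reduce
        rw [height_spanLattice hA, (hf.1 s hs).2]

end SpanLattice

/-! ### Faces of zonotopes -/

section Zonotope

variable {E : Type*} [NormedAddCommGroup E] [NormedSpace ℝ E] {k : ℕ} {z : Fin k → E} {t : E}
  {Z : Set E}

theorem mem_zonotope_iff (hZ : (fun x => t + x) '' Z =
    {x | ∃ r : Fin k → ℝ, (∀ i, -1 ≤ r i ∧ r i ≤ 1) ∧ x = ∑ i, r i • z i}) {x : E} :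
    x ∈ Z ↔ ∃ r : Fin k → ℝ, (∀ i, |r i| ≤ 1) ∧ t + x = ∑ i, r i • z i := by
  rw [← (add_right_injective t).mem_set_image, hZ]
  simp only [abs_le, Set.mem_ofPred_eq]

variable (hZ : ∀ x, x ∈ Z ↔ ∃ r : Fin k → ℝ, (∀ i, |r i| ≤ 1) ∧ t + x = ∑ i, r i • z i)
include hZ

/-- A point of the zonotope maximizes `l` exactly when every coefficient `r i` with `l (z i) ≠ 0`
is the sign of `l (z i)`. -/
theorem mem_face_iff (l : StrongDual ℝ E) {x : E} :
    (x ∈ Z ∧ ∀ y ∈ Z, l y ≤ l x) ↔ ∃ r : Fin k → ℝ, (∀ i, |r i| ≤ 1) ∧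
      (∀ i, r i * l (z i) = |l (z i)|) ∧ t + x = ∑ i, r i • z i := by
  have hval : ∀ {x : E} {r : Fin k → ℝ}, t + x = ∑ i, r i • z i →
      l t + l x = ∑ i, r i * l (z i) := fun h => by
    rw [← map_add, h, map_sum]
    simp
  have hle : ∀ {r : Fin k → ℝ}, (∀ i, |r i| ≤ 1) → ∀ i, r i * l (z i) ≤ |l (z i)| := by
    intro r hr i
    refine (le_abs_self _).trans ?_
    rw [abs_mul]
    exact mul_le_of_le_one_left (abs_nonneg _) (hr i)
  constructor
  · rintro ⟨hx, hmax⟩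
    obtain ⟨r, hr, hxr⟩ := (hZ x).1 hx
    refine ⟨r, hr, fun i => ?_, hxr⟩
    -- The vertex with coefficients `sign (l (z i))` attains the upper bound `∑ i, |l (z i)|`.
    let σ : Fin k → ℝ := fun i => SignType.sign (l (z i))
    have hσ : t + (∑ i, σ i • z i - t) = ∑ i, σ i • z i := by abel
    have h1 := hmax _ ((hZ _).2 ⟨σ, fun i => by
      rcases lt_trichotomy (l (z i)) 0 with h | h | h <;> simp [σ, h], hσ⟩)
    have h2 := hval hσ
    have h3 := hval hxr
    have h4 : ∑ i, σ i * l (z i) = ∑ i, |l (z i)| := by simp [σ, sign_mul_self]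
    refine (sum_eq_sum_iff_of_le fun i _ => hle hr i).1 (le_antisymm
      (sum_le_sum fun i _ => hle hr i) ?_) i (mem_univ i)
    linarith
  · rintro ⟨r, hr, hrl, hxr⟩
    refine ⟨(hZ x).2 ⟨r, hr, hxr⟩, fun y hy => ?_⟩
    obtain ⟨r', hr', hyr⟩ := (hZ y).1 hy
    have h1 := hval hxr
    have h2 := hval hyr
    have h3 : ∑ i, r' i * l (z i) ≤ ∑ i, r i * l (z i) :=
      sum_le_sum fun i _ => (hle hr' i).trans (hrl i).ge
    linarith

theorem face_nonempty (l : StrongDual ℝ E) : {x ∈ Z | ∀ y ∈ Z, l y ≤ l x}.Nonempty := by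
  refine ⟨∑ i, (SignType.sign (l (z i)) : ℝ) • z i - t, (mem_face_iff hZ l).2
    ⟨fun i => SignType.sign (l (z i)), fun i => ?_, fun i => sign_mul_self _, by abel⟩⟩
  rcases lt_trichotomy (l (z i)) 0 with h | h | h <;> simp [h]

theorem vectorSpan_face (l : StrongDual ℝ E) :
    vectorSpan ℝ {x ∈ Z | ∀ y ∈ Z, l y ≤ l x} =
      Submodule.span ℝ (z '' {i | l (z i) = 0}) := by
  apply le_antisymm
  · refine Submodule.span_le.2 ?_
    rintro _ ⟨x, hx, y, hy, rfl⟩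
    obtain ⟨r, -, hr, hxr⟩ := (mem_face_iff hZ l).1 hx
    obtain ⟨r', -, hr', hyr⟩ := (mem_face_iff hZ l).1 hy
    have : x -ᵥ y = ∑ i, (r i - r' i) • z i := by
      simp only [sub_smul, sum_sub_distrib, ← hxr, ← hyr, vsub_eq_sub]
      abel
    beta_reduce
    rw [SetLike.mem_coe, this]
    refine sum_mem fun i _ => ?_
    by_cases h : l (z i) = 0
    · exact Submodule.smul_mem _ _ (Submodule.subset_span ⟨i, h, rfl⟩)
    · rw [mul_right_cancel₀ h ((hr i).trans (hr' i).symm), sub_self, zero_smul]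
      exact zero_mem _
  · refine Submodule.span_le.2 ?_
    rintro _ ⟨i, hi, rfl⟩
    obtain ⟨x, hx⟩ := face_nonempty hZ l
    obtain ⟨r, hr, hrl, hxr⟩ := (mem_face_iff hZ l).1 hx
    -- The coefficient of a generator killed by `l` can be moved from `0` to `1` within the face.
    have hsum : ∀ c : ℝ, ∑ j, Function.update r i c j • z j = t + x + (c - r i) • z i := by
      intro c
      rw [hxr, ← add_sum_erase _ _ (mem_univ i),
        ← add_sum_erase _ (fun j => r j • z j) (mem_univ i),
        Function.update_self, sub_smul, sum_congr rfl fun j hj => by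
          rw [Function.update_of_ne (ne_of_mem_erase hj)]]
      abel
    have hmem : ∀ c : ℝ, |c| ≤ 1 → x + (c - r i) • z i ∈ {x ∈ Z | ∀ y ∈ Z, l y ≤ l x} := by
      intro c hc
      refine (mem_face_iff hZ l).2 ⟨Function.update r i c, fun j => ?_, fun j => ?_, ?_⟩
      · rcases eq_or_ne j i with rfl | h
        · simpa using hc
        · simpa [h] using hr j
      · rcases eq_or_ne j i with rfl | h
        · simp [show l (z j) = 0 from hi]
        · simpa [h] using hrl j
      · rw [hsum, add_assoc]
    have := vsub_mem_vectorSpan ℝ (hmem 1 (by simp)) (hmem 0 (by simp))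
    rwa [vsub_eq_sub, add_sub_add_left_eq_sub, ← sub_smul, sub_sub_sub_cancel_right, sub_zero,
      one_smul] at this

theorem vectorSpan_zonotope : vectorSpan ℝ Z = Submodule.span ℝ (Set.range z) := by
  simpa using vectorSpan_face hZ 0

variable [FiniteDimensional ℝ E]

/-- The flats of a zonotope are the spans of sets of generators. A span `L` is realized by the face
in a direction `l` that vanishes on `L` but on no generator outside `L`. -/
theorem flats_zonotope : flats Z = spanLattice (Set.range z) := by
  ext L
  constructor
  · rintro ⟨F, hF, hexp, rfl⟩
    obtain ⟨l, rfl⟩ := hexp hF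
    rw [vectorSpan_face hZ]
    exact ⟨_, Set.image_subset_range _ _, rfl⟩
  · intro hL
    obtain ⟨f, hf⟩ := Module.exists_dual_forall_apply_ne_zero (K := ℝ)
      (fun i : {i // z i ∉ L} => L.mkQ (z i)) fun i => by simpa using i.2
    let l : StrongDual ℝ E := LinearMap.toContinuousLinearMap (f ∘ₗ L.mkQ)
    have hl : ∀ i, l (z i) = 0 ↔ z i ∈ L := fun i =>
      ⟨fun h => by_contra fun hi => hf ⟨i, hi⟩ h, fun h => by
        change f (L.mkQ (z i)) = 0
        rw [(Submodule.Quotient.mk_eq_zero L).2 h |> (show L.mkQ (z i) = 0 from ·), map_zero]⟩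
    refine ⟨_, face_nonempty hZ l, fun _ => ⟨l, rfl⟩, ?_⟩
    rw [vectorSpan_face hZ]
    conv_rhs => rw [← span_inter_eq hL]
    congr 1
    ext x
    constructor
    · rintro ⟨i, hi, rfl⟩
      exact ⟨⟨i, rfl⟩, (hl i).1 hi⟩
    · rintro ⟨⟨i, rfl⟩, hi⟩
      exact ⟨i, (hl i).2 hi, rfl⟩

end Zonotope

/-! ### Flag-vectors and affine spans -/

theorem flagWhitney_congr {P Q : Type*} [PartialOrder P] [PartialOrder Q] (e : P ≃o Q)
    (S : Set ℕ) : flagWhitney P S = flagWhitney Q S := by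
  rw [flagWhitney, ← (Set.image_injective.2 e.injective).injOn.ncard_image, flagWhitney]
  congr 1
  ext c
  constructor
  · rintro ⟨c, ⟨hc, hr⟩, rfl⟩
    refine ⟨e.monotone.isChain_image hc, ?_⟩
    rw [Set.image_image, ← hr]
    simp only [Order.height_orderIso]
  · rintro ⟨hc, hr⟩
    refine ⟨e.symm '' c, ⟨e.symm.monotone.isChain_image hc, ?_⟩, ?_⟩
    · rw [Set.image_image, ← hr]
      simp only [Order.height_orderIso]
    · simp [Set.image_image]

theorem flagVector_congr (d : ℕ) {P Q : Type*} [PartialOrder P] [PartialOrder Q] (e : P ≃o Q) :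
    flagVector d P = flagVector d Q := by
  ext S
  rw [flagVector, flagVector, flagWhitney_congr e]

theorem flagVector_empty (d : ℕ) (P : Type*) [PartialOrder P] : flagVector d P ∅ = 1 := by
  have : {c : Set P | IsChain (· ≤ ·) c ∧ (fun a : P => Order.height a) '' c =
      (fun s : ℕ => (s : ℕ∞)) '' ∅} = {∅} := by
    ext c
    simp only [Set.image_empty, Set.image_eq_empty, Set.mem_ofPred_eq, Set.mem_singleton_iff]
    exact ⟨fun h => h.2, fun h => ⟨h ▸ IsChain.empty, h⟩⟩
  rw [flagVector, coe_empty, Set.image_empty, flagWhitney, this, Set.ncard_singleton, Nat.cast_one]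

/-- The index `i : Fin d` stands for the rank `i + 1`. -/
def succEmbedding (d : ℕ) : Fin d ↪ ℕ :=
  ⟨fun i => (i : ℕ) + 1, fun i j h => Fin.ext (by simpa using h)⟩

/-- Restriction of a function of rank sets to the subsets of `{1, …, d}`, indexed as in
`flagVector`. -/
noncomputable def restrictRanks (d : ℕ) : (Finset ℕ → ℝ) →ₗ[ℝ] (Finset (Fin d) → ℝ) :=
  LinearMap.funLeft ℝ ℝ fun S => S.map (succEmbedding d)

theorem restrictRanks_surjective (d : ℕ) : Function.Surjective (restrictRanks d) :=
  LinearMap.funLeft_surjective_of_injective ℝ ℝ _ (map_injective _)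

theorem map_succEmbedding_subset {d : ℕ} (S : Finset (Fin d)) :
    S.map (succEmbedding d) ⊆ Icc 1 d := by
  intro s hs
  obtain ⟨i, -, rfl⟩ := mem_map.1 hs
  exact mem_Icc.2 ⟨Nat.succ_pos _, i.2⟩

theorem flagVector_spanLattice {E : Type*} [AddCommGroup E] [Module ℝ E] [FiniteDimensional ℝ E]
    {A : Set E} (hA : A.Finite) (d : ℕ) :
    flagVector d (spanLattice A) = restrictRanks d (flagCount A) := by
  ext S
  have : (fun i : Fin d => (i : ℕ) + 1) '' (S : Set (Fin d)) = S.map (succEmbedding d) :=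
    (coe_map (succEmbedding d) S).symm
  rw [flagVector, this, flagWhitney_spanLattice hA]
  rfl

theorem exists_of_mem_zonotopeFlagVectors {d : ℕ} {v : Finset (Fin d) → ℝ}
    (hv : v ∈ zonotopeFlagVectors d) : ∃ (n : ℕ) (A : Set (EuclideanSpace ℝ (Fin n))), A.Finite ∧
      Module.finrank ℝ (Submodule.span ℝ A) = d + 1 ∧ v = flagVector d (spanLattice A) := by
  obtain ⟨n, Z, ⟨k, z, t, -, hZ⟩, hd, rfl⟩ := hv
  have hZ' := fun x => mem_zonotope_iff (x := x) hZ
  refine ⟨n, Set.range z, Set.finite_range z, ?_, ?_⟩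
  · rw [← vectorSpan_zonotope hZ', hd]
  · rw [flats_zonotope hZ']

theorem flagVector_spanLattice_mem_zonotopeFlagVectors {d n : ℕ}
    {A : Set (EuclideanSpace ℝ (Fin n))} (hA : A.Finite) (h0 : 0 ∉ A)
    (hd : Module.finrank ℝ (Submodule.span ℝ A) = d + 1) :
    flagVector d (spanLattice A) ∈ zonotopeFlagVectors d := by
  obtain ⟨k, z, -, rfl⟩ := hA.fin_param
  let Z : Set (EuclideanSpace ℝ (Fin n)) :=
    {x | ∃ r : Fin k → ℝ, (∀ i, -1 ≤ r i ∧ r i ≤ 1) ∧ x = ∑ i, r i • z i}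
  have hZ : (fun x => 0 + x) '' Z = Z := by simp
  have hZ' := fun x => mem_zonotope_iff (x := x) hZ
  refine ⟨n, Z, ⟨k, z, 0, fun i hi => h0 ⟨i, hi⟩, hZ⟩, ?_, ?_⟩
  · rw [vectorSpan_zonotope hZ', hd]
  · rw [flats_zonotope hZ']

theorem zonotopeFlagVectors_subset_posetFlagVectors (d : ℕ) :
    zonotopeFlagVectors d ⊆ posetFlagVectors.{u} d := by
  intro v hv
  obtain ⟨n, A, hA, hd, rfl⟩ := exists_of_mem_zonotopeFlagVectors hv
  let _ := spanLatticeBoundedOrder A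
  let _ := spanLatticeGradeMinOrder A
  have := (finite_spanLattice hA).to_subtype
  let e : ULift.{u} (spanLattice A) ≃o spanLattice A := ULift.orderIso
  refine ⟨ULift.{u} (spanLattice A), inferInstance, inferInstance, ⟨inferInstance,
    GradeMinOrder.liftRight e e.strictMono (fun a b h => (apply_covBy_apply_iff e).2 h)
      fun a h => (e.isMin_apply).2 h, ?_⟩, (flagVector_congr d e).symm⟩
  exact hd

theorem span_zonotopeFlagVectors (d : ℕ) :
    Submodule.span ℝ (zonotopeFlagVectors d) = ⊤ := by
  have htop : flagSpan (EuclideanSpace ℝ (Fin (d + 1))) d = ⊤ := flagSpan_eq_top (by simp)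
  rw [eq_top_iff, ← LinearMap.range_eq_top.2 (restrictRanks_surjective d),
    LinearMap.range_eq_map, ← htop, Submodule.map_le_iff_le_comap, flagSpan, Submodule.span_le]
  rintro v (⟨A, hA, h0, hd, rfl⟩ | hv)
  · refine Submodule.subset_span ?_
    rw [← flagVector_spanLattice hA]
    exact flagVector_spanLattice_mem_zonotopeFlagVectors hA h0 hd
  · have : restrictRanks d v = 0 := funext fun S => hv _ (map_succEmbedding_subset S)
    simp [this]

/-- Points with `i`-th coordinate `1` that linearly span the space affinely span that hyperplane.
-/
theorem vectorSpan_eq_ker_proj {ι : Type*} {i : ι} {s : Set (ι → ℝ)} (hs : ∀ v ∈ s, v i = 1)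
    (hne : s.Nonempty) (hspan : Submodule.span ℝ s = ⊤) :
    vectorSpan ℝ s = LinearMap.ker (LinearMap.proj (R := ℝ) (φ := fun _ : ι => ℝ) i) := by
  apply le_antisymm
  · refine Submodule.span_le.2 ?_
    rintro _ ⟨v, hv, w, hw, rfl⟩
    simp [hs v hv, hs w hw]
  · obtain ⟨w, hw⟩ := hne
    intro v hv
    have key : ∀ v ∈ Submodule.span ℝ s, v - v i • w ∈ vectorSpan ℝ s := by
      intro v hv
      induction hv using Submodule.span_induction with
      | mem v hv => simpa [hs v hv] using vsub_mem_vectorSpan ℝ hv hw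
      | zero => simp
      | add a b _ _ ha hb =>
        have := add_mem ha hb
        rwa [sub_add_sub_comm, ← add_smul] at this
      | smul c a _ ha =>
        have := Submodule.smul_mem _ c ha
        rwa [smul_sub, smul_smul] at this
    have hv0 : v i = 0 := hv
    simpa [hv0] using key v (hspan ▸ Submodule.mem_top)

theorem finrank_ker_proj {ι : Type*} [Fintype ι] (i : ι) :
    Module.finrank ℝ (LinearMap.ker (LinearMap.proj (R := ℝ) (φ := fun _ : ι => ℝ) i)) =
      Fintype.card ι - 1 := by
  have h := LinearMap.finrank_range_add_finrank_ker
    (LinearMap.proj (R := ℝ) (φ := fun _ : ι => ℝ) i)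
  rw [LinearMap.range_eq_top.2 (LinearMap.proj_surjective i), finrank_top, Module.finrank_self,
    Module.finrank_fintype_fun_eq_card] at h
  omega

end ZonoFlag

theorem mainTheorem5 (d : ℕ) :
    (ZonoFlag.zonotopeFlagVectors d).Nonempty ∧
    affineSpan ℝ (ZonoFlag.zonotopeFlagVectors d) =
      affineSpan ℝ (ZonoFlag.posetFlagVectors.{u} d) ∧
    Module.finrank ℝ (affineSpan ℝ (ZonoFlag.zonotopeFlagVectors d)).direction = 2 ^ d - 1 := by
  have hspan := ZonoFlag.span_zonotopeFlagVectors d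
  have hsub := ZonoFlag.zonotopeFlagVectors_subset_posetFlagVectors.{u} d
  have hne : (ZonoFlag.zonotopeFlagVectors d).Nonempty := by
    by_contra h
    rw [Set.not_nonempty_iff_eq_empty.1 h, Submodule.span_empty] at hspan
    exact bot_ne_top hspan
  have hposet : ∀ v ∈ ZonoFlag.posetFlagVectors.{u} d, v ∅ = 1 := by
    rintro _ ⟨P, _, _, -, rfl⟩
    exact ZonoFlag.flagVector_empty d P
  have hdir := ZonoFlag.vectorSpan_eq_ker_proj (fun v hv => hposet v (hsub hv)) hne hspan
  have hdir' := ZonoFlag.vectorSpan_eq_ker_proj hposet (hne.mono hsub)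
    (top_le_iff.1 (hspan.ge.trans (Submodule.span_mono hsub)))
  refine ⟨hne, ?_, ?_⟩
  · refine AffineSubspace.ext_of_direction_eq ?_ ?_
    · rw [direction_affineSpan, direction_affineSpan, hdir, hdir']
    · obtain ⟨v, hv⟩ := hne
      exact ⟨v, subset_affineSpan ℝ _ hv, subset_affineSpan ℝ _ (hsub hv)⟩
  · rw [direction_affineSpan, hdir, ZonoFlag.finrank_ker_proj, Fintype.card_finset,
      Fintype.card_fin]
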